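/- Let $n\ge 1$, let $\mathbb{B}_n=\{z\in\mathbb{C}^n:|z|<1\}$, and let $\langle z,w\rangle=\sum_{i} z_i\overline{w_i}$. Equip $\mathbb{B}_n$ with the Bergman metric $$g_{i\bar j}(z)=\frac{1}{n+1}\,\frac{\partial^2}{\partial z_i\,\partial\overline{z_j}}\log K(z,z)=\frac{(1-|z|^2)\delta_{ij}+\overline{z_i}z_j}{(1-|z|^2)^2},\qquad K(z,w)=\frac{1}{(1-\langle z,w\rangle)^{n+1}},$$ that is, with the Riemannian metric $\langle V,W\rangle_b=\operatorname{Re}\sum_{i,j}g_{i\bar j}(z)V_i\overline{W_j}$, whose volume density is $(1-|z|^2)^{-n-1}$. Let $U:\mathbb{B}_n\to\mathbb{R}$ be $C^\infty$ and let $c\in\mathbb{R}$ be such that the level set $M=\{z\in\mathbb{B}_n:U(z)=c\}$ is compact and the Euclidean gradient $\nabla U$ (of $U$ as a function on $\mathbb{R}^{2n}$, viewed as a vector in $\mathbb{C}^n$) does not vanish on $M$. Let $P(M)$ be the Bergman perimeter of $M$, i.e. the total $(2n-1)$-dimensional area of the hypersurface $M$ for the Riemannian metric induced on $M$ by the Bergman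 metric. Then $P(M)$ is finite, the function under the integral below is integrable on $M$, and $$P(M)=\int_{M}(1-|z|^2)^{-n-\frac12}\sqrt{1-\left|\left\langle \frac{\nabla U}{|\nabla U|},z\right\rangle\right|^2}\;d\mathcal{H}^{2n-1}(z),$$ where $\mathcal{H}^{2n-1}$ is the Euclidean $(2n-1)$-dimensional Hausdorff measure, normalized to agree with Lebesgue measure on $\mathbb{R}^{2n-1}$. -/

import Mathlib

open MeasureTheory Set
open scoped ContDiff ENNReal

noncomputable section

namespace BergmanBall

/-- The complex Euclidean space `ℂⁿ`, with its Euclidean norm. -/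
abbrev Cn (n : ℕ) : Type := EuclideanSpace ℂ (Fin n)

/-- The real parameter space `ℝ²ⁿ⁻¹` of a real hypersurface of `ℂⁿ`. -/
abbrev ParamSpace (n : ℕ) : Type := EuclideanSpace ℝ (Fin (2 * n - 1))

/-- The open unit ball of `ℂⁿ`. -/
abbrev unitBall (n : ℕ) : Set (Cn n) := Metric.ball 0 1

/-- The standard Hermitian product `⟨z, w⟩ = ∑ zᵢ * conj wᵢ`, linear in the first variable. -/
def herm {n : ℕ} (z w : Cn n) : ℂ := ∑ i, z i * starRingEnd ℂ (w i)

/-- The Bergman kernel `K(z, w) = (1 - ⟨z, w⟩)^{-(n+1)}` of the unit ball. -/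
def bergmanKernel {n : ℕ} (z w : Cn n) : ℂ := 1 / (1 - herm z w) ^ (n + 1)

/-- The Wirtinger derivative `∂/∂zᵢ = (∂/∂xᵢ - i ∂/∂yᵢ) / 2`. -/
def wirtinger {n : ℕ} (i : Fin n) (f : Cn n → ℂ) (z : Cn n) : ℂ :=
  (fderiv ℝ f z (EuclideanSpace.single i 1)
    - Complex.I * fderiv ℝ f z (EuclideanSpace.single i Complex.I)) / 2

/-- The conjugate Wirtinger derivative `∂/∂z̄ᵢ = (∂/∂xᵢ + i ∂/∂yᵢ) / 2`. -/
def wirtingerBar {n : ℕ} (i : Fin n) (f : Cn n → ℂ) (z : Cn n) : ℂ :=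
  (fderiv ℝ f z (EuclideanSpace.single i 1)
    + Complex.I * fderiv ℝ f z (EuclideanSpace.single i Complex.I)) / 2

/-- The component `g_{i j̄}` of the Bergman metric tensor: `∂²/∂zᵢ∂z̄ⱼ` of `log K(z, z)`, divided by
the constant `n + 1`, so that
`g_{i j̄}(z) = ((1 - |z|²) δᵢⱼ + z̄ᵢ zⱼ) / (1 - |z|²)²` and the volume density is
`(1 - |z|²)^{-n-1}`. -/
def bergmanTensor {n : ℕ} (z : Cn n) (i j : Fin n) : ℂ :=
  (1 / ((n : ℂ) + 1)) *
    wirtinger i (wirtingerBar j fun w => Complex.log (bergmanKernel w w)) z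

/-- The real inner product `⟨v, w⟩_b = Re ∑ g_{i j̄}(z) vᵢ w̄ⱼ` on the tangent space at `z`. -/
def bergmanInner {n : ℕ} (z v w : Cn n) : ℝ :=
  (∑ i, ∑ j, bergmanTensor z i j * v i * starRingEnd ℂ (w j)).re

/-- The density, in the coordinates given by `φ`, of the Riemannian area form of the metric induced
by the Bergman metric: the square root of the Gram determinant of the coordinate vector fields. -/
def areaDensity {n : ℕ} (φ : ParamSpace n → Cn n) (x : ParamSpace n) : ℝ :=
  Real.sqrt (Matrix.det (Matrix.of fun i j : Fin (2 * n - 1) =>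
    bergmanInner (φ x) (fderiv ℝ φ x (EuclideanSpace.single i 1))
      (fderiv ℝ φ x (EuclideanSpace.single j 1))))

/-- A smooth local parametrization `φ : V → M` of the hypersurface `M`: an injective immersion of an
open subset `V` of `ℝ²ⁿ⁻¹` with values in `M`. -/
structure IsLocalParam {n : ℕ} (M : Set (Cn n)) (V : Set (ParamSpace n))
    (φ : ParamSpace n → Cn n) : Prop where
  isOpen : IsOpen V
  smooth : ContDiffOn ℝ ∞ φ V
  injOn : InjOn φ V
  immersion : ∀ x ∈ V, Function.Injective (fderiv ℝ φ x)
  mapsTo : MapsTo φ V M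

/-- A countable family of pairwise disjoint pieces `φₖ(Sₖ)` of `M`, where `φₖ : Vₖ → M` is a local
parametrization and `Sₖ ⊆ Vₖ` is a Borel set. -/
structure Pieces {n : ℕ} (M : Set (Cn n)) where
  /-- the parameter domains -/
  V : ℕ → Set (ParamSpace n)
  /-- the local parametrizations -/
  φ : ℕ → ParamSpace n → Cn n
  /-- the Borel parts of the parameter domains that are used -/
  S : ℕ → Set (ParamSpace n)
  isLocalParam : ∀ k, IsLocalParam M (V k) (φ k)
  measurableSet : ∀ k, MeasurableSet (S k)
  subset : ∀ k, S k ⊆ V k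
  disjoint : Pairwise fun k l => Disjoint (φ k '' S k) (φ l '' S l)

/-- The Bergman perimeter of a hypersurface `M` of the unit ball: its total area for the Riemannian
metric induced on `M` by the Bergman metric. It is the supremum of the areas of the disjoint unions
of parametrized pieces of `M`, the area of a piece `φ(S)` being the integral over `S` of the
Riemannian area density; it is attained at every decomposition of `M` into such pieces. -/
def bergmanPerimeter {n : ℕ} (M : Set (Cn n)) : ℝ≥0∞ :=
  ⨆ P : Pieces M, ∑' k, ∫⁻ x in P.S k, ENNReal.ofReal (areaDensity (P.φ k) x)

/-- The function `(1 - |z|²)^{-n-1/2} * √(1 - |⟨∇U/|∇U|, z⟩|²)`, where `∇U` is the Euclidean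
gradient of `U` on `ℂⁿ = ℝ²ⁿ`, seen as a vector of `ℂⁿ`. -/
def perimeterIntegrand {n : ℕ} (U : Cn n → ℝ) (z : Cn n) : ℝ :=
  (1 - ‖z‖ ^ 2) ^ (-(n : ℝ) - 1 / 2) *
    Real.sqrt (1 - ‖herm ((‖gradient U z‖⁻¹ : ℝ) • gradient U z) z‖ ^ 2)

end BergmanBall

end

/-! The statement reduces to a pointwise comparison of two area densities on a local parametrization
of $M$. Put $k=(1-|z|^2)^{-1}$. Differentiating $\log K$ twice shows that the Bergman inner product
is $k$ times the Euclidean one plus $k^2$ times the squares of the pairings with $z$ and $iz$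
(`bergmanInner_eq`). On the hyperplane orthogonal to the unit normal $N$ this is a rank two
perturbation of a multiple of the identity, so its Gram determinant reduces to a 2×2 one
(`det_gram_add_rank_two`). The Bergman density is therefore the Euclidean one times the integrand
(`areaDensity_eq`).

The area formula turns parameter integrals into Hausdorff integrals over the images
(`ContDiffOn.setLIntegral_image_euclideanHausdorffMeasure`), and the inverse function theorem
supplies enough parametrizations to exhaust $M$ (`exists_isLocalParam`). Compactness enters only for
finiteness: $M$ has finite Hausdorff measure and the continuous integrand is bounded on it. -/

/-! ### Area formula for injective immersions -/

/-- If distances between values of `f` are at most `L` times those between values of `g`, then the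
`d`-dimensional measure of the image under `f` is at most `L ^ d` times that of the image
under `g`. -/
theorem euclideanHausdorffMeasure_image_le_of_edist_le {X E F : Type*} [EMetricSpace E]
    [MeasurableSpace E] [BorelSpace E] [EMetricSpace F] [MeasurableSpace F] [BorelSpace F]
    {f : X → E} {g : X → F} {S : Set X} {L : NNReal}
    (h : ∀ x ∈ S, ∀ y ∈ S, edist (f x) (f y) ≤ L * edist (g x) (g y)) (d : ℕ) :
    μHE[d] (f '' S) ≤ (L : ℝ≥0∞) ^ d * μHE[d] (g '' S) := by
  rcases S.eq_empty_or_nonempty with rfl | ⟨x₀, -⟩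
  · simp
  have : Nonempty X := ⟨x₀⟩
  -- Points of `S` with equal `g`-values have equal `f`-values, so `f` factors through `g` by an
  -- `L`-Lipschitz map.
  have hinv : ∀ x ∈ S, f (Function.invFunOn g S (g x)) = f x := fun x hx => by
    have h1 := Function.invFunOn_mem (f := g) (s := S) ⟨x, hx, rfl⟩
    have h2 := Function.invFunOn_eq (f := g) (s := S) ⟨x, hx, rfl⟩
    have h3 := h _ h1 x hx
    rw [h2, edist_self, mul_zero, nonpos_iff_eq_zero, edist_eq_zero] at h3
    exact h3
  have hL : LipschitzOnWith L (f ∘ Function.invFunOn g S) (g '' S) := by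
    rintro _ ⟨x, hx, rfl⟩ _ ⟨y, hy, rfl⟩
    simpa [hinv x hx, hinv y hy] using h x hx y hy
  have himg : (f ∘ Function.invFunOn g S) '' (g '' S) = f '' S := by
    rw [image_image]
    exact image_congr fun x hx => hinv x hx
  have key := hL.hausdorffMeasure_image_le (d := d) (by positivity)
  rw [himg, ENNReal.rpow_natCast] at key
  simp only [Measure.euclideanHausdorffMeasure_def, Measure.smul_apply,
    Measure.nnreal_smul_coe_apply]
  rw [mul_left_comm]
  gcongr

section AreaFormula

variable {E F : Type*} [NormedAddCommGroup E] [InnerProductSpace ℝ E] [FiniteDimensional ℝ E]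
  [MeasurableSpace E] [BorelSpace E]
  [NormedAddCommGroup F] [InnerProductSpace ℝ F] [MeasurableSpace F] [BorelSpace F]

-- In an orthonormal basis `normDet` is the square root of a Gram determinant, a polynomial in inner
-- products.
omit [MeasurableSpace E] [BorelSpace E] [MeasurableSpace F] [BorelSpace F] in
theorem ContinuousLinearMap.continuous_normDet :
    Continuous fun A : E →L[ℝ] F => (A : E →ₗ[ℝ] F).normDet := by
  let b := stdOrthonormalBasis ℝ E
  have : (fun A : E →L[ℝ] F => (A : E →ₗ[ℝ] F).normDet) =
      fun A : E →L[ℝ] F => √(Matrix.of fun i j => inner ℝ (A (b i)) (A (b j))).det := by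
    ext A
    have h := (A : E →ₗ[ℝ] F).normDet_sq_eq_det_gram b
    rw [← Real.sqrt_sq (LinearMap.normDet_nonneg _)]
    exact congrArg _ h
  rw [this]
  fun_prop

-- Near `x`, strict differentiability makes distances under `f` and under `A` agree up to the factor
-- `L`; the image of a set under the linear map `A` has an exactly known measure.
open Topology in
theorem HasStrictFDerivAt.exists_euclideanHausdorffMeasure_image_bounds {f : E → F} {A : E →L[ℝ] F}
    {x : E} (hf : HasStrictFDerivAt f A x) (hA : Function.Injective A) {L : NNReal} (hL : 1 < L) :
    ∃ s ∈ 𝓝 x, ∀ S ⊆ s,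
      μHE[Module.finrank ℝ E] (f '' S) ≤ (L : ℝ≥0∞) ^ Module.finrank ℝ E *
        (ENNReal.ofReal (A : E →ₗ[ℝ] F).normDet * volume S) ∧
      ENNReal.ofReal (A : E →ₗ[ℝ] F).normDet * volume S ≤
        (L : ℝ≥0∞) ^ Module.finrank ℝ E * μHE[Module.finrank ℝ E] (f '' S) := by
  obtain ⟨K, hK, hanti⟩ := (LinearMap.injective_iff_antilipschitz (A : E →ₗ[ℝ] F)).1 hA
  have hL' : (1 : ℝ) < L := by exact_mod_cast hL
  have hK' : (0 : ℝ) < K := by exact_mod_cast hK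
  have hLi : (L : ℝ)⁻¹ < 1 := inv_lt_one_of_one_lt₀ hL'
  have hc : (0 : ℝ) < (1 - (L : ℝ)⁻¹) / K := div_pos (by linarith) hK'
  -- Since `‖v‖ ≤ K * ‖A v‖`, this constant makes the error at most `(1 - L⁻¹) * ‖A v‖`. The lower
  -- bound `L⁻¹` is then immediate, and the upper bound `2 - L⁻¹ ≤ L` follows from `L + L⁻¹ ≥ 2`.
  obtain ⟨s, hs, happ⟩ := hf.approximates_deriv_on_nhds
    (c := ⟨(1 - (L : ℝ)⁻¹) / K, hc.le⟩) (Or.inr hc)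
  have hbd : ∀ y ∈ s, ∀ z ∈ s, ‖f y - f z - A (y - z)‖ ≤ (1 - (L : ℝ)⁻¹) * ‖A (y - z)‖ := by
    intro y hy z hz
    have h1 : ‖f y - f z - A (y - z)‖ ≤ (1 - (L : ℝ)⁻¹) / K * ‖y - z‖ := happ y hy z hz
    have h2 : ‖y - z‖ ≤ K * ‖A (y - z)‖ := by
      simpa [dist_eq_norm, map_sub] using hanti.le_mul_dist y z
    calc _ ≤ (1 - (L : ℝ)⁻¹) / K * (K * ‖A (y - z)‖) := h1.trans (by gcongr)
      _ = _ := by field_simp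
  have hle1 : ∀ y ∈ s, ∀ z ∈ s, edist (f y) (f z) ≤ L * edist (A y) (A z) := by
    intro y hy z hz
    rw [edist_nndist, edist_nndist]
    norm_cast
    rw [← NNReal.coe_le_coe]
    push_cast
    rw [dist_eq_norm, dist_eq_norm, ← map_sub]
    have h1 := hbd y hy z hz
    have h2 := norm_le_insert' (f y - f z) (A (y - z))
    have h3 : 1 + (1 - (L : ℝ)⁻¹) ≤ L := by
      have : (L : ℝ) * (L : ℝ)⁻¹ = 1 := mul_inv_cancel₀ (by positivity)
      nlinarith
    nlinarith [norm_nonneg (A (y - z))]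
  have hle2 : ∀ y ∈ s, ∀ z ∈ s, edist (A y) (A z) ≤ L * edist (f y) (f z) := by
    intro y hy z hz
    rw [edist_nndist, edist_nndist]
    norm_cast
    rw [← NNReal.coe_le_coe]
    push_cast
    rw [dist_eq_norm, dist_eq_norm, ← map_sub]
    have h1 := hbd y hy z hz
    have h2 := norm_le_insert (f y - f z) (A (y - z))
    have h3 : (L : ℝ)⁻¹ * ‖A (y - z)‖ ≤ ‖f y - f z‖ := by linarith
    rwa [inv_mul_le_iff₀ (by positivity)] at h3
  refine ⟨s, hs, fun S hS => ?_⟩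
  rw [← LinearMap.euclideanHausdorffMeasure_image_eq_normDet_mul_volume]
  exact ⟨euclideanHausdorffMeasure_image_le_of_edist_le
      (fun y hy z hz => hle1 y (hS hy) z (hS hz)) _,
    euclideanHausdorffMeasure_image_le_of_edist_le
      (fun y hy z hz => hle2 y (hS hy) z (hS hz)) _⟩

-- Freezing the Jacobian at `x` costs one more factor `L`, by continuity; hence the exponent
-- `finrank + 1`.
open Topology in
theorem ContDiffOn.exists_euclideanHausdorffMeasure_image_bounds {f : E → F} {V : Set E}
    (hV : IsOpen V) (hf : ContDiffOn ℝ 1 f V) {x : E} (hx : x ∈ V)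
    (hinj : Function.Injective (fderiv ℝ f x)) {L : NNReal} (hL : 1 < L) :
    ∃ s, IsOpen s ∧ x ∈ s ∧ ∀ S ⊆ s, MeasurableSet S →
      μHE[Module.finrank ℝ E] (f '' S) ≤ (L : ℝ≥0∞) ^ (Module.finrank ℝ E + 1) *
        ∫⁻ y in S, ENNReal.ofReal (fderiv ℝ f y : E →ₗ[ℝ] F).normDet ∧
      ∫⁻ y in S, ENNReal.ofReal (fderiv ℝ f y : E →ₗ[ℝ] F).normDet ≤
        (L : ℝ≥0∞) ^ (Module.finrank ℝ E + 1) * μHE[Module.finrank ℝ E] (f '' S) := by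
  have hL' : (1 : ℝ) < L := by exact_mod_cast hL
  have hcd : ContDiffAt ℝ 1 f x := hf.contDiffAt (hV.mem_nhds hx)
  obtain ⟨s, hs, hbd⟩ := (hcd.hasStrictFDerivAt one_ne_zero
    ).exists_euclideanHausdorffMeasure_image_bounds hinj hL
  set J : E → ℝ := fun y => (fderiv ℝ f y : E →ₗ[ℝ] F).normDet with hJ
  have hJpos : 0 < J x := (LinearMap.normDet_nonneg _).lt_of_ne'
    (((LinearMap.normDet_ne_zero_tfae _).out 0 4).2 hinj)
  have hJc : ContinuousAt J x :=
    ContinuousLinearMap.continuous_normDet.continuousAt.comp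
      (hf.continuousOn_fderiv_of_isOpen hV le_rfl |>.continuousAt (hV.mem_nhds hx))
  have h1 : ∀ᶠ y in 𝓝 x, J y < L * J x :=
    hJc.eventually_lt continuousAt_const (by nlinarith)
  have h2 : ∀ᶠ y in 𝓝 x, J x < L * J y :=
    continuousAt_const.eventually_lt (continuousAt_const.mul hJc) (by nlinarith)
  obtain ⟨t, htsub, hto, hxt⟩ := mem_nhds_iff.1 (Filter.inter_mem hs (h1.and h2))
  refine ⟨t, hto, hxt, fun S hS hSm => ?_⟩
  obtain ⟨hb1, hb2⟩ := hbd S fun y hy => (htsub (hS hy)).1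
  have hi1 : ENNReal.ofReal (J x) * volume S ≤ L * ∫⁻ y in S, ENNReal.ofReal (J y) := by
    rw [← lintegral_const_mul' _ _ ENNReal.coe_ne_top, ← setLIntegral_const]
    refine setLIntegral_mono' hSm fun y hy => ?_
    rw [← ENNReal.ofReal_coe_nnreal, ← ENNReal.ofReal_mul (by positivity)]
    exact ENNReal.ofReal_le_ofReal (htsub (hS hy)).2.2.le
  have hi2 : ∫⁻ y in S, ENNReal.ofReal (J y) ≤ L * (ENNReal.ofReal (J x) * volume S) := by
    rw [← mul_assoc, ← setLIntegral_const]
    refine setLIntegral_mono' hSm fun y hy => ?_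
    rw [← ENNReal.ofReal_coe_nnreal, ← ENNReal.ofReal_mul (by positivity)]
    exact ENNReal.ofReal_le_ofReal (htsub (hS hy)).2.1.le
  constructor
  · refine hb1.trans ?_
    rw [pow_succ, mul_assoc]
    gcongr
  · refine hi2.trans ?_
    rw [pow_succ', mul_assoc]
    gcongr

-- Second countability extracts a countable subcover. Nonemptiness is what allows it to be
-- enumerated by `ℕ`.
omit [MeasurableSpace E] [BorelSpace E] in
theorem exists_seq_isOpen_cover_of_local {P : E → Set E → Prop} {V S : Set E} (hS : S ⊆ V)
    (h : ∀ x ∈ V, ∃ s, IsOpen s ∧ x ∈ s ∧ P x s) (hne : S.Nonempty) :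
    ∃ u : ℕ → Set E, (∀ k, IsOpen (u k) ∧ ∃ x ∈ V, P x (u k)) ∧ S ⊆ ⋃ k, u k := by
  choose! s hso hxs hP using h
  obtain ⟨t, htS, htc, hcov⟩ := TopologicalSpace.countable_cover_nhdsWithin (s := S) (f := s)
    fun x hx => mem_nhdsWithin_of_mem_nhds ((hso x (hS hx)).mem_nhds (hxs x (hS hx)))
  have htne : t.Nonempty := by
    obtain ⟨x, hx⟩ := hne
    obtain ⟨y, hy, -⟩ := mem_iUnion₂.1 (hcov hx)
    exact ⟨y, hy⟩
  obtain ⟨e, rfl⟩ := htc.exists_eq_range htne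
  refine ⟨fun k => s (e k), fun k => ⟨hso _ (hS (htS ⟨k, rfl⟩)), e k, hS (htS ⟨k, rfl⟩),
    hP _ (hS (htS ⟨k, rfl⟩))⟩, ?_⟩
  simpa using hcov

open Filter Topology in
/-- A number that is at most `L ^ m * b` for all `L > 1` is at most `b`. -/
theorem ENNReal.le_of_forall_one_lt_pow_mul {a b : ℝ≥0∞} (m : ℕ)
    (h : ∀ L : NNReal, 1 < L → a ≤ (L : ℝ≥0∞) ^ m * b) : a ≤ b := by
  have ht : Tendsto (fun L : NNReal => (L : ℝ≥0∞) ^ m * b) (𝓝[>] 1)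
      (𝓝 (((1 : NNReal) : ℝ≥0∞) ^ m * b)) :=
    ENNReal.Tendsto.mul_const
      ((((ENNReal.continuous_pow m).comp ENNReal.continuous_coe).tendsto 1).mono_left
        nhdsWithin_le_nhds) (Or.inl (by simp))
  have := ge_of_tendsto ht (eventually_nhdsWithin_of_forall fun L hL => h L hL)
  simpa using this

/-- **Area formula** for injective immersions. -/
theorem ContDiffOn.euclideanHausdorffMeasure_image {f : E → F} {V S : Set E}
    (hV : IsOpen V) (hf : ContDiffOn ℝ 1 f V) (hinj : InjOn f V)
    (himm : ∀ x ∈ V, Function.Injective (fderiv ℝ f x)) (hS : MeasurableSet S) (hSV : S ⊆ V) :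
    μHE[Module.finrank ℝ E] (f '' S) =
      ∫⁻ y in S, ENNReal.ofReal (fderiv ℝ f y : E →ₗ[ℝ] F).normDet := by
  rcases S.eq_empty_or_nonempty with rfl | hne
  · simp
  have key : ∀ L : NNReal, 1 < L →
      μHE[Module.finrank ℝ E] (f '' S) ≤ (L : ℝ≥0∞) ^ (Module.finrank ℝ E + 1) *
        ∫⁻ y in S, ENNReal.ofReal (fderiv ℝ f y : E →ₗ[ℝ] F).normDet ∧
      ∫⁻ y in S, ENNReal.ofReal (fderiv ℝ f y : E →ₗ[ℝ] F).normDet ≤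
        (L : ℝ≥0∞) ^ (Module.finrank ℝ E + 1) * μHE[Module.finrank ℝ E] (f '' S) := by
    intro L hL
    -- The local bounds add up over a disjoint refinement of the cover with the same factor, which
    -- tends to 1 as `L` does.
    obtain ⟨u, hu, hcov⟩ := exists_seq_isOpen_cover_of_local hSV
      (fun x hx => hf.exists_euclideanHausdorffMeasure_image_bounds hV hx (himm x hx) hL) hne
    have hT : ∀ k, MeasurableSet (S ∩ disjointed u k) := fun k =>
      hS.inter (MeasurableSet.disjointed (fun k => (hu k).1.measurableSet) k)
    have hdisj : Pairwise (Function.onFun Disjoint fun k => S ∩ disjointed u k) := fun i j hij =>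
      (disjoint_disjointed u hij).mono inter_subset_right inter_subset_right
    have hSeq : S = ⋃ k, S ∩ disjointed u k := by
      rw [← inter_iUnion, iUnion_disjointed, inter_eq_left.2 hcov]
    have hm : μHE[Module.finrank ℝ E] (f '' S) =
        ∑' k, μHE[Module.finrank ℝ E] (f '' (S ∩ disjointed u k)) := by
      conv_lhs => rw [hSeq, image_iUnion]
      refine measure_iUnion (fun i j hij => ?_) fun k => ?_
      · rw [Function.onFun, disjoint_iff_inter_eq_empty,
          ← hinj.image_inter (inter_subset_left.trans hSV) (inter_subset_left.trans hSV),
          disjoint_iff_inter_eq_empty.1 (hdisj hij), image_empty]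
      · exact (hT k).image_of_continuousOn_injOn
          (hf.continuousOn.mono (inter_subset_left.trans hSV))
          (hinj.mono (inter_subset_left.trans hSV))
    have hl : ∫⁻ y in S, ENNReal.ofReal (fderiv ℝ f y : E →ₗ[ℝ] F).normDet =
        ∑' k, ∫⁻ y in S ∩ disjointed u k, ENNReal.ofReal (fderiv ℝ f y : E →ₗ[ℝ] F).normDet := by
      conv_lhs => rw [hSeq]
      exact lintegral_iUnion hT hdisj _
    have hk : ∀ k, _ := fun k => (hu k).2.choose_spec.2 (S ∩ disjointed u k)
      (inter_subset_right.trans (disjointed_subset u k)) (hT k)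
    rw [hm, hl, ← ENNReal.tsum_mul_left, ← ENNReal.tsum_mul_left]
    exact ⟨ENNReal.tsum_le_tsum fun k => (hk k).1, ENNReal.tsum_le_tsum fun k => (hk k).2⟩
  exact le_antisymm
    (ENNReal.le_of_forall_one_lt_pow_mul _ fun L hL => (key L hL).1)
    (ENNReal.le_of_forall_one_lt_pow_mul _ fun L hL => (key L hL).2)

/-- **Change of variables** for integrals over parametrized pieces of submanifolds. -/
theorem ContDiffOn.setLIntegral_image_euclideanHausdorffMeasure {f : E → F} {V S : Set E}
    (hV : IsOpen V) (hf : ContDiffOn ℝ 1 f V) (hinj : InjOn f V)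
    (himm : ∀ x ∈ V, Function.Injective (fderiv ℝ f x)) (hS : MeasurableSet S) (hSV : S ⊆ V)
    {g : F → ℝ≥0∞} (hg : AEMeasurable g (μHE[Module.finrank ℝ E].restrict (f '' S))) :
    ∫⁻ z in f '' S, g z ∂μHE[Module.finrank ℝ E] =
      ∫⁻ y in S, ENNReal.ofReal (fderiv ℝ f y : E →ₗ[ℝ] F).normDet * g (f y) := by
  set J : E → ℝ≥0∞ := fun y => ENNReal.ofReal (fderiv ℝ f y : E →ₗ[ℝ] F).normDet
  have hJ : AEMeasurable J (volume.restrict S) := by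
    refine ENNReal.measurable_ofReal.comp_aemeasurable (ContinuousOn.aemeasurable ?_ hS)
    exact ContinuousLinearMap.continuous_normDet.comp_continuousOn
      ((hf.continuousOn_fderiv_of_isOpen hV le_rfl).mono hSV)
  have hfm : AEMeasurable f ((volume.restrict S).withDensity J) :=
    ((hf.continuousOn.mono hSV).aemeasurable hS).mono_ac (withDensity_absolutelyContinuous _ _)
  have hmap : μHE[Module.finrank ℝ E].restrict (f '' S) =
      Measure.map f ((volume.restrict S).withDensity J) := by
    ext t ht
    rw [Measure.restrict_apply ht, Measure.map_apply_of_aemeasurable hfm ht]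
    -- Only the restriction of `f` to `S` is known to be continuous, so the preimage is taken in the
    -- subtype.
    have hpre : MeasurableSet (f ⁻¹' t ∩ S) := by
      have := hS.subtype_image ((hf.continuousOn.mono hSV).domRestrict.measurable ht)
      rwa [domRestrict_eq, preimage_comp, Subtype.image_preimage_coe, inter_comm] at this
    rw [← restrict_withDensity hS, Measure.restrict_apply' hS, withDensity_apply _ hpre,
      inter_comm t, ← image_inter_preimage, inter_comm S]
    exact hf.euclideanHausdorffMeasure_image hV hinj himm hpre (inter_subset_right.trans hSV)
  rw [hmap] at hg ⊢
  rw [lintegral_map' hg hfm]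
  exact lintegral_withDensity_eq_lintegral_mul₀' hJ (hg.comp_aemeasurable hfm)

end AreaFormula

/-! ### Gram determinants on a hyperplane -/

/-- The rank one identity for an orthonormal basis of the orthogonal complement of a unit vector. -/
theorem exists_sum_inner_mul_inner_eq_sub {F : Type*} [NormedAddCommGroup F] [InnerProductSpace ℝ F]
    [FiniteDimensional ℝ F] {m : ℕ} (hm : Module.finrank ℝ F = m + 1) {N : F} (hN : ‖N‖ = 1) :
    ∃ b : Fin m → F, ∀ x y : F, ∑ l, inner ℝ x (b l) * inner ℝ (b l) y =
      inner ℝ x y - inner ℝ x N * inner ℝ N y := by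
  have hN0 : N ≠ 0 := fun h => by simp [h] at hN
  have : Fact (Module.finrank ℝ F = m + 1) := ⟨hm⟩
  have hr : Module.finrank ℝ (ℝ ∙ N)ᗮ = m := Submodule.finrank_orthogonal_span_singleton hN0
  let b := (stdOrthonormalBasis ℝ (ℝ ∙ N)ᗮ).reindex (finCongr hr)
  have hproj : ∀ x : F, (((ℝ ∙ N)ᗮ.orthogonalProjectionOnto x : (ℝ ∙ N)ᗮ) : F) =
      x - inner ℝ N x • N := by
    intro x
    rw [← Submodule.starProjection_apply, Submodule.starProjection_orthogonal_val,
      Submodule.starProjection_unit_singleton ℝ hN]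
  refine ⟨fun l => b l, fun x y => ?_⟩
  have h := b.sum_inner_mul_inner ((ℝ ∙ N)ᗮ.orthogonalProjectionOnto x)
    ((ℝ ∙ N)ᗮ.orthogonalProjectionOnto y)
  have e1 : ∀ l, inner ℝ ((ℝ ∙ N)ᗮ.orthogonalProjectionOnto x) (b l) = inner ℝ x (b l : F) :=
    fun l => Submodule.inner_orthogonalProjectionOnto_eq_of_mem_right _ _
  have e2 : ∀ l, inner ℝ (b l) ((ℝ ∙ N)ᗮ.orthogonalProjectionOnto y) = inner ℝ (b l : F) y :=
    fun l => Submodule.inner_orthogonalProjectionOnto_eq_of_mem_left _ _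
  simp only [e1, e2] at h
  rw [h, Submodule.coe_inner, hproj, hproj]
  simp only [inner_sub_left, inner_sub_right, inner_smul_left, inner_smul_right,
    real_inner_self_eq_norm_sq, hN, real_inner_comm N x, conj_trivial]
  ring

/-- The Gram determinant of vectors in the hyperplane orthogonal to a unit vector `N`, for the
Euclidean product perturbed along two orthogonal vectors `p`, `q` of equal length. -/
theorem det_gram_add_rank_two {F : Type*} [NormedAddCommGroup F] [InnerProductSpace ℝ F]
    [FiniteDimensional ℝ F] {m : ℕ} (hm : Module.finrank ℝ F = m + 1) {N : F} (hN : ‖N‖ = 1)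
    {p q : F} {r : ℝ} (hp : ‖p‖ = r) (hq : ‖q‖ = r) (hpq : inner ℝ p q = 0) (hr : 1 - r ^ 2 ≠ 0)
    {a : Fin m → F} (ha : ∀ i, inner ℝ (a i) N = 0) :
    (Matrix.of fun i j => (1 - r ^ 2)⁻¹ * inner ℝ (a i) (a j) + (1 - r ^ 2)⁻¹ ^ 2 *
      (inner ℝ (a i) p * inner ℝ (a j) p + inner ℝ (a i) q * inner ℝ (a j) q)).det =
    (1 - r ^ 2)⁻¹ ^ (m + 2) * (1 - (inner ℝ N p ^ 2 + inner ℝ N q ^ 2)) *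
      (Matrix.of fun i j => inner ℝ (a i) (a j)).det := by
  obtain ⟨b, hb⟩ := exists_sum_inner_mul_inner_eq_sub hm hN
  set k := (1 - r ^ 2)⁻¹ with hk
  have hkr : k * (1 - r ^ 2) = 1 := inv_mul_cancel₀ hr
  -- The rows of `B` are the coordinates of the `a i` in the hyperplane, and the columns of `P`
  -- those of the projections of `p` and `q`. The perturbed Gram matrix is `B * k(1 + k P Pᵀ) * Bᵀ`.
  let B : Matrix (Fin m) (Fin m) ℝ := Matrix.of fun i l => inner ℝ (a i) (b l)
  let P : Matrix (Fin m) (Fin 2) ℝ := Matrix.of fun l s => inner ℝ (b l) (![p, q] s)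
  have hBB : B * B.transpose = Matrix.of fun i j => inner ℝ (a i) (a j) := by
    ext i j
    simp only [B, Matrix.mul_apply, Matrix.transpose_apply, Matrix.of_apply]
    simp_rw [real_inner_comm (b _) (a j)]
    rw [hb, ha, zero_mul, sub_zero]
  have hBP : B * P = Matrix.of fun i s => inner ℝ (a i) (![p, q] s) := by
    ext i s
    simp only [B, P, Matrix.mul_apply, Matrix.of_apply]
    rw [hb, ha, zero_mul, sub_zero]
  have hPP : P.transpose * P = Matrix.of fun s t => inner ℝ (![p, q] s) (![p, q] t) -
      inner ℝ (![p, q] s) N * inner ℝ N (![p, q] t) := by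
    ext s t
    simp only [P, Matrix.mul_apply, Matrix.transpose_apply, Matrix.of_apply]
    simp_rw [real_inner_comm (![p, q] s) (b _)]
    rw [hb]
  have hfac : (Matrix.of fun i j => k * inner ℝ (a i) (a j) + k ^ 2 *
      (inner ℝ (a i) p * inner ℝ (a j) p + inner ℝ (a i) q * inner ℝ (a j) q)) =
      B * (k • (1 + P * (k • P.transpose))) * B.transpose := by
    have : B * (k • (1 + P * (k • P.transpose))) * B.transpose =
        k • (B * B.transpose) + k ^ 2 • ((B * P) * (B * P).transpose) := by
      rw [Matrix.transpose_mul]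
      simp only [Matrix.mul_smul, Matrix.smul_mul, Matrix.mul_add, Matrix.add_mul, Matrix.mul_one,
        smul_add, smul_smul, Matrix.mul_assoc, sq]
    rw [this, hBB, hBP]
    ext i j
    simp [Matrix.mul_apply, Fin.sum_univ_two]
  -- Sylvester's identity replaces `P Pᵀ` by the 2×2 matrix `Pᵀ P`.
  rw [hfac, Matrix.det_mul_right_comm, Matrix.det_mul, hBB, Matrix.det_smul,
    Matrix.det_one_add_mul_comm, Matrix.smul_mul, hPP, Matrix.det_fin_two]
  have h00 : inner ℝ p p = r ^ 2 := by rw [real_inner_self_eq_norm_sq, hp]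
  have h11 : inner ℝ q q = r ^ 2 := by rw [real_inner_self_eq_norm_sq, hq]
  simp only [Matrix.add_apply, Matrix.smul_apply, Matrix.of_apply, Matrix.cons_val_zero,
    Matrix.cons_val_one, Matrix.one_apply_eq, Matrix.one_apply_ne zero_ne_one,
    Matrix.one_apply_ne one_ne_zero, h00, h11, hpq, real_inner_comm p q, real_inner_comm N p,
    real_inner_comm N q, smul_eq_mul, Fintype.card_fin]
  -- With this relation the 2×2 determinant is `k² ((1 - s²)(1 - t²) - s² t²) = k² (1 - s² - t²)`.
  have e : 1 + k * r ^ 2 = k := by linarith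
  generalize inner ℝ N p = s
  generalize inner ℝ N q = t
  linear_combination (Matrix.of fun i j => (inner ℝ (a i) (a j) : ℝ)).det * k ^ m *
    (1 + k * r ^ 2 + k - k * s ^ 2 - k * t ^ 2) * e

/-! ### The Bergman tensor in closed form -/

namespace BergmanBall

variable {n : ℕ}

theorem herm_self (z : Cn n) : herm z z = ((‖z‖ ^ 2 : ℝ) : ℂ) := by
  simp [herm, EuclideanSpace.norm_sq_eq, Complex.mul_conj, Complex.normSq_eq_norm_sq]

theorem re_herm (v w : Cn n) : (herm v w).re = inner ℝ v w := by
  simp only [herm, PiLp.inner_apply, Complex.inner, Complex.re_sum]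
  refine Finset.sum_congr rfl fun i _ => ?_
  simp [mul_comm]

theorem im_herm (v w : Cn n) : (herm v w).im = inner ℝ v (Complex.I • w) := by
  rw [← re_herm]
  simp only [herm, Complex.re_sum, Complex.im_sum]
  refine Finset.sum_congr rfl fun i _ => ?_
  simp
  ring

theorem norm_herm_sq (v w : Cn n) :
    ‖herm v w‖ ^ 2 = inner ℝ v w ^ 2 + inner ℝ v (Complex.I • w) ^ 2 := by
  rw [← re_herm, ← im_herm, Complex.sq_norm, Complex.normSq_apply]
  ring

theorem one_sub_norm_sq_pos {z : Cn n} (hz : z ∈ unitBall n) : 0 < 1 - ‖z‖ ^ 2 := by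
  have hz1 : ‖z‖ < 1 := by simpa using hz
  nlinarith [norm_nonneg z]

theorem log_bergmanKernel {z : Cn n} (hz : z ∈ unitBall n) :
    Complex.log (bergmanKernel z z) = ((-(n + 1) * Real.log (1 - ‖z‖ ^ 2) : ℝ) : ℂ) := by
  have h := one_sub_norm_sq_pos hz
  have : bergmanKernel z z = ((1 / (1 - ‖z‖ ^ 2) ^ (n + 1) : ℝ) : ℂ) := by
    rw [bergmanKernel, herm_self]
    push_cast
    rfl
  rw [this, ← Complex.ofReal_log (by positivity), one_div, Real.log_inv, Real.log_pow]
  push_cast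
  ring

theorem hasFDerivAt_inv_one_sub_norm_sq {z : Cn n} (hz : z ∈ unitBall n) :
    HasFDerivAt (fun w : Cn n => (1 - ‖w‖ ^ 2)⁻¹)
      ((2 * ((1 - ‖z‖ ^ 2)⁻¹) ^ 2 : ℝ) • innerSL ℝ z) z := by
  have h := one_sub_norm_sq_pos hz
  have h1 : HasFDerivAt (fun w : Cn n => 1 - ‖w‖ ^ 2) (-(2 • innerSL ℝ z)) z :=
    (hasStrictFDerivAt_norm_sq z).hasFDerivAt.const_sub 1
  refine ((hasDerivAt_inv h.ne').comp_hasFDerivAt z h1).congr_fderiv ?_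
  ext v
  simp
  ring

theorem hasFDerivAt_log_bergmanKernel {z : Cn n} (hz : z ∈ unitBall n) :
    HasFDerivAt (fun w : Cn n => Complex.log (bergmanKernel w w))
      (Complex.ofRealCLM ∘L ((2 * (n + 1) * (1 - ‖z‖ ^ 2)⁻¹ : ℝ) • innerSL ℝ z)) z := by
  have h := one_sub_norm_sq_pos hz
  have h1 : HasFDerivAt (fun w : Cn n => 1 - ‖w‖ ^ 2) (-(2 • innerSL ℝ z)) z :=
    (hasStrictFDerivAt_norm_sq z).hasFDerivAt.const_sub 1
  have h2 : HasFDerivAt (fun w : Cn n => -((n : ℝ) + 1) * Real.log (1 - ‖w‖ ^ 2))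
      ((2 * (n + 1) * (1 - ‖z‖ ^ 2)⁻¹ : ℝ) • innerSL ℝ z) z := by
    refine ((h1.log h.ne').const_mul (-((n : ℝ) + 1))).congr_fderiv ?_
    ext v
    simp
    ring
  refine (Complex.ofRealCLM.hasFDerivAt.comp z h2).congr_of_eventuallyEq ?_
  filter_upwards [Metric.isOpen_ball.mem_nhds hz] with w hw
  exact log_bergmanKernel hw

theorem inner_single_one (z : Cn n) (i : Fin n) :
    inner ℝ z (EuclideanSpace.single i (1 : ℂ)) = (z i).re := by
  rw [← re_herm, herm, Finset.sum_eq_single i (by intro j _ h; simp [h]) (by simp)]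
  simp

theorem inner_single_I (z : Cn n) (i : Fin n) :
    inner ℝ z (EuclideanSpace.single i Complex.I) = (z i).im := by
  rw [← re_herm, herm, Finset.sum_eq_single i (by intro j _ h; simp [h]) (by simp)]
  simp

theorem wirtingerBar_log_bergmanKernel {z : Cn n} (hz : z ∈ unitBall n) (j : Fin n) :
    wirtingerBar j (fun w => Complex.log (bergmanKernel w w)) z =
      ((1 - ‖z‖ ^ 2)⁻¹ : ℝ) • (((n : ℂ) + 1) * z j) := by
  rw [wirtingerBar, (hasFDerivAt_log_bergmanKernel hz).fderiv]
  simp only [ContinuousLinearMap.comp_apply, smul_apply, innerSL_apply_apply,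
    inner_single_one, inner_single_I, Complex.ofRealCLM_apply, smul_eq_mul, Complex.real_smul]
  conv_rhs => rw [← Complex.re_add_im (z j)]
  push_cast
  ring

theorem bergmanTensor_eq {z : Cn n} (hz : z ∈ unitBall n) (i j : Fin n) :
    bergmanTensor z i j = (((1 - ‖z‖ ^ 2)⁻¹ : ℝ) : ℂ) * (if i = j then 1 else 0) +
      (((1 - ‖z‖ ^ 2)⁻¹ : ℝ) : ℂ) ^ 2 * (starRingEnd ℂ (z i) * z j) := by
  have hcoord : HasFDerivAt (fun w : Cn n => ((n : ℂ) + 1) * w j)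
      (((n : ℂ) + 1) • (EuclideanSpace.proj (𝕜 := ℂ) j).restrictScalars ℝ) z :=
    ((EuclideanSpace.proj (𝕜 := ℂ) j).restrictScalars ℝ).hasFDerivAt.const_mul _
  -- The first-order formula holds on a neighbourhood of `z`, so the product rule applies to it.
  have hd : HasFDerivAt (wirtingerBar j fun w : Cn n => Complex.log (bergmanKernel w w)) _ z :=
    ((hasFDerivAt_inv_one_sub_norm_sq hz).smul hcoord).congr_of_eventuallyEq (by
      filter_upwards [Metric.isOpen_ball.mem_nhds hz] with w hw
      exact wirtingerBar_log_bergmanKernel hw j)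
  have hn : (n : ℂ) + 1 ≠ 0 := by exact_mod_cast n.succ_ne_zero
  rw [bergmanTensor, wirtinger, hd.fderiv]
  simp only [add_apply, smul_apply, innerSL_apply_apply,
    inner_single_one, inner_single_I, smul_eq_mul, Complex.real_smul,
    ContinuousLinearMap.smulRight_apply, ContinuousLinearMap.coe_restrictScalars',
    PiLp.proj_apply, PiLp.single_apply, eq_comm (a := j)]
  have hc : starRingEnd ℂ (z i) = (z i).re - Complex.I * (z i).im := by
    apply Complex.ext <;> simp
  rw [hc]
  push_cast
  generalize ((1 : ℂ) - (‖z‖ : ℂ) ^ 2)⁻¹ = k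
  split_ifs
  · field_simp
    linear_combination (-k) * Complex.I_sq
  · field_simp
    ring

/-- The tensor contracts to `k⟨v,w⟩ + k²⟨v,z⟩` times the conjugate of `⟨w,z⟩`. The real and
imaginary parts of `⟨·,z⟩` are the real pairings with `z` and `iz`, two orthogonal vectors of equal
length, as `det_gram_add_rank_two` requires. -/
theorem bergmanInner_eq {z : Cn n} (hz : z ∈ unitBall n) (v w : Cn n) :
    bergmanInner z v w = (1 - ‖z‖ ^ 2)⁻¹ * inner ℝ v w + (1 - ‖z‖ ^ 2)⁻¹ ^ 2 *
      (inner ℝ v z * inner ℝ w z + inner ℝ v (Complex.I • z) * inner ℝ w (Complex.I • z)) := by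
  have : (∑ i, ∑ j, bergmanTensor z i j * v i * starRingEnd ℂ (w j)) =
      (((1 - ‖z‖ ^ 2)⁻¹ : ℝ) : ℂ) * herm v w +
      (((1 - ‖z‖ ^ 2)⁻¹ : ℝ) : ℂ) ^ 2 * (herm v z * starRingEnd ℂ (herm w z)) := by
    simp only [bergmanTensor_eq hz, herm, map_sum,
      Finset.sum_mul_sum (f := fun i => v i * starRingEnd ℂ (z i)), Finset.mul_sum,
      add_mul, Finset.sum_add_distrib]
    congr 1
    · refine Finset.sum_congr rfl fun i _ => ?_
      rw [Finset.sum_eq_single i (by intro j _ h; simp [h.symm]) (by simp)]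
      simp [mul_assoc]
    · refine Finset.sum_congr rfl fun i _ => Finset.sum_congr rfl fun j _ => ?_
      simp
      ring
  rw [bergmanInner, this]
  rw [← im_herm, ← im_herm, ← re_herm, ← re_herm, ← re_herm]
  rw [← Complex.ofReal_pow, Complex.add_re, Complex.re_ofReal_mul, Complex.re_ofReal_mul]
  simp

/-! ### Comparison of the two area densities -/

theorem finrank_real_Cn (n : ℕ) : Module.finrank ℝ (Cn n) = 2 * n := by
  rw [finrank_real_of_complex, finrank_euclideanSpace_fin]

/-- The Bergman area density of a parametrization whose tangent space is orthogonal to `G`, in terms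
of the Euclidean one. -/
theorem areaDensity_eq (hn : 1 ≤ n) {φ : ParamSpace n → Cn n} {x : ParamSpace n}
    (hz : φ x ∈ unitBall n) {G : Cn n} (hG : G ≠ 0)
    (ht : ∀ v, inner ℝ (fderiv ℝ φ x v) G = 0) :
    areaDensity φ x = (fderiv ℝ φ x : ParamSpace n →ₗ[ℝ] Cn n).normDet *
      ((1 - ‖φ x‖ ^ 2) ^ (-(n : ℝ) - 1 / 2) *
        √(1 - ‖herm ((‖G‖⁻¹ : ℝ) • G) (φ x)‖ ^ 2)) := by
  have hpos := one_sub_norm_sq_pos hz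
  have hN : ‖(‖G‖⁻¹ : ℝ) • G‖ = 1 := by
    rw [norm_smul, norm_inv, norm_norm, inv_mul_cancel₀ (norm_ne_zero_iff.2 hG)]
  have hm : Module.finrank ℝ (Cn n) = (2 * n - 1) + 1 := by
    rw [finrank_real_Cn]; omega
  have hI : ‖Complex.I • φ x‖ = ‖φ x‖ := by rw [norm_smul, Complex.norm_I, one_mul]
  have hpq : inner ℝ (φ x) (Complex.I • φ x) = 0 := by
    rw [← im_herm, herm_self, Complex.ofReal_im]
  have hdet := det_gram_add_rank_two hm hN (p := φ x) (q := Complex.I • φ x) rfl hI hpq hpos.ne'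
    (a := fun i => fderiv ℝ φ x (EuclideanSpace.single i 1))
    (fun i => by rw [inner_smul_right, ht, mul_zero])
  have hgram := (fderiv ℝ φ x : ParamSpace n →ₗ[ℝ] Cn n).normDet_sq_eq_det_gram
    (EuclideanSpace.basisFun (Fin (2 * n - 1)) ℝ)
  have hgram' : (Matrix.of fun i j : Fin (2 * n - 1) =>
      inner ℝ (fderiv ℝ φ x (EuclideanSpace.single i 1))
        (fderiv ℝ φ x (EuclideanSpace.single j 1))).det =
      (fderiv ℝ φ x : ParamSpace n →ₗ[ℝ] Cn n).normDet ^ 2 := by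
    simp only [EuclideanSpace.basisFun_apply] at hgram
    exact hgram.symm
  -- Here `m + 2 = 2n + 1` with `m = 2n - 1`, and half of it is the exponent `n + 1/2` of the
  -- integrand.
  have hexp : ((1 - ‖φ x‖ ^ 2)⁻¹) ^ (2 * n - 1 + 2) =
      ((1 - ‖φ x‖ ^ 2) ^ (-(n : ℝ) - 1 / 2)) ^ 2 := by
    rw [← Real.rpow_natCast, ← Real.rpow_mul_natCast hpos.le, Real.inv_rpow hpos.le,
      ← Real.rpow_neg hpos.le]
    congr 1
    rw [show 2 * n - 1 + 2 = 2 * n + 1 by omega]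
    push_cast
    ring
  simp only [areaDensity, bergmanInner_eq hz]
  rw [hdet, ← norm_herm_sq, hgram', hexp, Real.sqrt_mul' _ (sq_nonneg _),
    Real.sqrt_mul (sq_nonneg _),
    Real.sqrt_sq (by positivity), Real.sqrt_sq (LinearMap.normDet_nonneg _), mul_comm]

/-! ### Local parametrizations of regular level sets -/

open Topology in
/-- Every point of a regular level set has a neighbourhood of finite area that is the image of a
local parametrization. -/
theorem exists_isLocalParam (hn : 1 ≤ n) {U : Cn n → ℝ} {c : ℝ}
    (hU : ContDiffOn ℝ ∞ U (unitBall n)) {z : Cn n} (hz : z ∈ unitBall n) (hzc : U z = c)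
    (hG : gradient U z ≠ 0) :
    ∃ W, IsOpen W ∧ z ∈ W ∧ ∃ V φ, IsLocalParam {z ∈ unitBall n | U z = c} V φ ∧
      φ '' V = {z ∈ unitBall n | U z = c} ∩ W ∧
      μHE[2 * n - 1] ({z ∈ unitBall n | U z = c} ∩ W) < ⊤ := by
  set G := gradient U z
  have hm : Module.finrank ℝ (Cn n) = (2 * n - 1) + 1 := by
    rw [finrank_real_Cn]; omega
  have : Fact (Module.finrank ℝ (Cn n) = (2 * n - 1) + 1) := ⟨hm⟩
  have hr : Module.finrank ℝ (ℝ ∙ G)ᗮ = 2 * n - 1 := Submodule.finrank_orthogonal_span_singleton hG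
  let e : (ℝ ∙ G)ᗮ ≃ₗᵢ[ℝ] ParamSpace n :=
    ((stdOrthonormalBasis ℝ (ℝ ∙ G)ᗮ).reindex (finCongr hr)).repr
  let π : Cn n →L[ℝ] ParamSpace n :=
    (e : (ℝ ∙ G)ᗮ →L[ℝ] ParamSpace n) ∘L (ℝ ∙ G)ᗮ.orthogonalProjectionOnto
  -- `Ψ` straightens the level set: `U` detects the normal direction and `π` the tangential ones.
  -- The parametrization is the slice of its local inverse at first coordinate `c`.
  let Ψ : Cn n → ℝ × ParamSpace n := fun w => (U w, π w)
  let D : Cn n → (Cn n →L[ℝ] ℝ × ParamSpace n) := fun w => (fderiv ℝ U w).prod π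
  have hUat : ∀ w ∈ unitBall n, ContDiffAt ℝ ∞ U w := fun w hw =>
    hU.contDiffAt (Metric.isOpen_ball.mem_nhds hw)
  have hΨ : ∀ w ∈ unitBall n, ContDiffAt ℝ ∞ Ψ w := fun w hw =>
    (hUat w hw).prodMk π.contDiff.contDiffAt
  have hD : ∀ w ∈ unitBall n, HasFDerivAt Ψ (D w) w := fun w hw =>
    ((hUat w hw).differentiableAt (by simp)).hasFDerivAt.prodMk π.hasFDerivAt
  have hDc : ContinuousOn D (unitBall n) := by
    have := hU.continuousOn_fderiv_of_isOpen Metric.isOpen_ball (by simp)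
    refine ((continuousOn_const (c := ContinuousLinearMap.inl ℝ ℝ (ParamSpace n))).clm_comp
      this).add (continuousOn_const (c := ContinuousLinearMap.inr ℝ ℝ (ParamSpace n) ∘L π))
      |>.congr fun w _ => ?_
    ext v <;> simp [D]
  have hinj : Function.Injective (D z) := by
    rw [injective_iff_map_eq_zero]
    intro v hv
    have h1 : fderiv ℝ U z v = 0 := congrArg Prod.fst hv
    have h2 : π v = 0 := congrArg Prod.snd hv
    have h3 : inner ℝ G v = 0 := by
      rw [← h1]
      exact InnerProductSpace.toDual_symm_apply
    have h4 : (ℝ ∙ G)ᗮ.orthogonalProjectionOnto v = 0 := by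
      simpa [π] using h2
    rw [Submodule.orthogonalProjectionOnto_eq_zero_iff, Submodule.orthogonal_orthogonal] at h4
    obtain ⟨a, rfl⟩ := Submodule.mem_span_singleton.1 h4
    rw [inner_smul_right, mul_eq_zero, inner_self_eq_zero] at h3
    rcases h3 with rfl | h3
    · simp
    · exact absurd h3 hG
  have hfr : Module.finrank ℝ (Cn n) = Module.finrank ℝ (ℝ × ParamSpace n) := by
    rw [hm, Module.finrank_prod, finrank_euclideanSpace_fin, Module.finrank_self, add_comm]
  let D' : Cn n ≃L[ℝ] ℝ × ParamSpace n :=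
    (LinearEquiv.ofInjectiveOfFinrankEq (D z : Cn n →ₗ[ℝ] ℝ × ParamSpace n)
      hinj hfr).toContinuousLinearEquiv
  have hD' : (D' : Cn n →L[ℝ] ℝ × ParamSpace n) = D z := by
    ext v <;> rfl
  have hDz : HasFDerivAt Ψ (D' : Cn n →L[ℝ] ℝ × ParamSpace n) z := hD' ▸ hD z hz
  let g := (hΨ z hz).toOpenPartialHomeomorph Ψ hDz (by simp)
  have hgcoe : ∀ w, g w = (U w, π w) := fun w => rfl
  have hzg : z ∈ g.source := (hΨ z hz).mem_toOpenPartialHomeomorph_source hDz (by simp)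
  let φ : ParamSpace n → Cn n := fun y => g.symm (c, y)
  have hsymm : ∀ p ∈ g.target, g.symm p ∈ unitBall n →
      D (g.symm p) ∈ range ((↑) : (Cn n ≃L[ℝ] ℝ × ParamSpace n) → _) →
      ContDiffAt ℝ ∞ g.symm p := by
    rintro p hp hb ⟨A, hA⟩
    exact g.contDiffAt_symm (f₀' := A) hp (hA ▸ hD _ hb) (hΨ _ hb)
  have hφ : ∀ y, (c, y) ∈ g.target → φ y ∈ unitBall n →
      D (φ y) ∈ range ((↑) : (Cn n ≃L[ℝ] ℝ × ParamSpace n) → _) → ContDiffAt ℝ ∞ φ y :=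
    fun y hy hb hA => (hsymm _ hy hb hA).comp y (contDiffAt_const.prodMk contDiffAt_id)
  have hzt : (c, π z) ∈ g.target := by
    rw [← hzc, ← hgcoe]; exact g.map_source hzg
  have hφz : φ (π z) = z := by
    change g.symm (c, π z) = z
    rw [← hzc, ← hgcoe]; exact g.left_inv hzg
  obtain ⟨K, t, ht, hLip⟩ := ((hφ (π z) hzt (by rwa [hφz])
    (by rw [hφz]; exact ⟨D', hD'⟩)).of_le (m := 1) (by simp)).exists_lipschitzOnWith
  obtain ⟨r, hr0, hrt⟩ := Metric.mem_nhds_iff.1 ht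
  -- Invertibility of `D` keeps the inverse smooth away from the base point; the condition on `π`
  -- confines the parameters to a ball where `φ` is Lipschitz, which bounds the area.
  let O : Set (Cn n) := (unitBall n ∩ D ⁻¹' range ((↑) : (Cn n ≃L[ℝ] ℝ × ParamSpace n) → _)) ∩
    π ⁻¹' Metric.ball (π z) r
  have hO : IsOpen O := (hDc.isOpen_inter_preimage Metric.isOpen_ball
    ContinuousLinearEquiv.isOpen).inter (Metric.isOpen_ball.preimage π.continuous)
  let V : Set (ParamSpace n) := (fun y => (c, y)) ⁻¹' (g.target ∩ g.symm ⁻¹' O)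
  have hV : IsOpen V := (g.isOpen_inter_preimage_symm hO).preimage (by fun_prop)
  have hgφ : ∀ y ∈ V, (U (φ y), π (φ y)) = (c, y) := fun y hy => g.right_inv hy.1
  have himg : φ '' V = {z ∈ unitBall n | U z = c} ∩ (g.source ∩ O) := by
    ext w
    constructor
    · rintro ⟨y, hy, rfl⟩
      exact ⟨⟨hy.2.1.1, congrArg Prod.fst (hgφ y hy)⟩, g.map_target hy.1, hy.2⟩
    · rintro ⟨⟨hw, hwc⟩, hws, hwO⟩
      have h1 : g.symm (c, π w) = w := by
        rw [← hwc, ← hgcoe]; exact g.left_inv hws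
      refine ⟨π w, ⟨?_, ?_⟩, h1⟩
      · change (c, π w) ∈ g.target
        rw [← hwc, ← hgcoe]; exact g.map_source hws
      · change g.symm (c, π w) ∈ O
        rwa [h1]
  have hsm : ∀ y ∈ V, ContDiffAt ℝ ∞ φ y := fun y hy => hφ y hy.1 hy.2.1.1 hy.2.1.2
  refine ⟨g.source ∩ O, g.open_source.inter hO, ⟨hzg, ⟨hz, D', hD'⟩, Metric.mem_ball_self hr0⟩, V, φ,
    ⟨hV, fun y hy => (hsm y hy).contDiffWithinAt, ?_, ?_, ?_⟩, himg, ?_⟩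
  · intro y hy y' hy' h
    have h1 := congrArg Prod.snd (hgφ y hy)
    have h2 := congrArg Prod.snd (hgφ y' hy')
    simp only at h1 h2
    rw [← h1, ← h2, h]
  · intro y hy
    -- `π` is a left inverse of `φ` on `V`, so its composite with the derivative of `φ` is the
    -- identity.
    have h1 : HasFDerivAt (fun y => π (φ y)) (π ∘L fderiv ℝ φ y) y :=
      π.hasFDerivAt.comp y ((hsm y hy).differentiableAt (by simp)).hasFDerivAt
    have h2 : HasFDerivAt (fun y => π (φ y)) (ContinuousLinearMap.id ℝ _) y :=
      (hasFDerivAt_id y).congr_of_eventuallyEq (by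
        filter_upwards [hV.mem_nhds hy] with y' hy'
        exact congrArg Prod.snd (hgφ y' hy'))
    have h3 := h1.unique h2
    refine Function.LeftInverse.injective (g := π) fun v => ?_
    exact congrArg (fun A : ParamSpace n →L[ℝ] ParamSpace n => A v) h3
  · intro y hy
    exact ⟨hy.2.1.1, congrArg Prod.fst (hgφ y hy)⟩
  · rw [← himg]
    have hVt : V ⊆ Metric.ball (π z) r := fun y hy => by
      have := hy.2.2
      have h1 : π (φ y) = y := congrArg Prod.snd (hgφ y hy)
      change π (φ y) ∈ Metric.ball (π z) r at this
      rwa [h1] at this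
    have hle := euclideanHausdorffMeasure_image_le_of_edist_le (f := φ) (g := id) (S := V) (L := K)
      (fun x hx y hy => hLip (hrt (hVt hx)) (hrt (hVt hy))) (2 * n - 1)
    rw [image_id, EuclideanSpace.euclideanHausdorffMeasure_eq_volume] at hle
    refine hle.trans_lt (ENNReal.mul_lt_top (by finiteness) ?_)
    exact (measure_mono hVt).trans_lt measure_ball_lt_top

/-! ### The perimeter as a Hausdorff integral -/

theorem continuous_herm : Continuous fun p : Cn n × Cn n => herm p.1 p.2 := by
  unfold herm
  fun_prop

theorem continuousOn_perimeterIntegrand {U : Cn n → ℝ} {c : ℝ}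
    (hU : ContDiffOn ℝ ∞ U (unitBall n))
    (hregular : ∀ z ∈ unitBall n, U z = c → gradient U z ≠ 0) :
    ContinuousOn (perimeterIntegrand U) {z ∈ unitBall n | U z = c} := by
  have hgrad : ContinuousOn (gradient U) {z ∈ unitBall n | U z = c} :=
    ((InnerProductSpace.toDual ℝ (Cn n)).symm.continuous.comp_continuousOn
      (hU.continuousOn_fderiv_of_isOpen Metric.isOpen_ball (by simp))).mono fun z hz => hz.1
  unfold perimeterIntegrand
  refine ContinuousOn.mul ?_ ?_
  · refine ContinuousOn.rpow_const (by fun_prop) fun z hz => Or.inl ?_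
    exact (one_sub_norm_sq_pos hz.1).ne'
  · refine Real.continuous_sqrt.comp_continuousOn (continuousOn_const.sub (ContinuousOn.pow ?_ 2))
    refine (continuous_herm.comp_continuousOn (ContinuousOn.prodMk ?_ continuousOn_id)).norm
    exact (hgrad.norm.inv₀ fun z hz => norm_ne_zero_iff.2 (hregular z hz.1 hz.2)).smul hgrad

theorem perimeterIntegrand_nonneg {U : Cn n → ℝ} {z : Cn n} (hz : z ∈ unitBall n) :
    0 ≤ perimeterIntegrand U z :=
  mul_nonneg (Real.rpow_nonneg (one_sub_norm_sq_pos hz).le _) (Real.sqrt_nonneg _)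

/-- The Riemannian area of a parametrized piece of a regular level set. -/
theorem IsLocalParam.lintegral_areaDensity (hn : 1 ≤ n) {U : Cn n → ℝ} {c : ℝ}
    (hU : ContDiffOn ℝ ∞ U (unitBall n))
    (hregular : ∀ z ∈ unitBall n, U z = c → gradient U z ≠ 0) {V S : Set (ParamSpace n)}
    {φ : ParamSpace n → Cn n} (h : IsLocalParam {z ∈ unitBall n | U z = c} V φ)
    (hS : MeasurableSet S) (hSV : S ⊆ V) :
    ∫⁻ x in S, ENNReal.ofReal (areaDensity φ x) =
      ∫⁻ z in φ '' S, ENNReal.ofReal (perimeterIntegrand U z) ∂μHE[2 * n - 1] := by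
  have hC1 : ContDiffOn ℝ 1 φ V := h.smooth.of_le (by simp)
  have hfr : Module.finrank ℝ (ParamSpace n) = 2 * n - 1 := finrank_euclideanSpace_fin
  have hm : MeasurableSet (φ '' S) :=
    hS.image_of_continuousOn_injOn (hC1.continuousOn.mono hSV) (h.injOn.mono hSV)
  have hsub : φ '' S ⊆ {z ∈ unitBall n | U z = c} := (h.mapsTo.mono_left hSV).image_subset
  have key := hC1.setLIntegral_image_euclideanHausdorffMeasure h.isOpen h.injOn h.immersion hS hSV
    (g := fun z => ENNReal.ofReal (perimeterIntegrand U z))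
    (ENNReal.measurable_ofReal.comp_aemeasurable
      (((continuousOn_perimeterIntegrand hU hregular).mono hsub).aemeasurable hm))
  rw [hfr] at key
  rw [key]
  refine setLIntegral_congr_fun hS fun x hx => ?_
  have hxM := h.mapsTo (hSV hx)
  have hφd : HasFDerivAt φ (fderiv ℝ φ x) x :=
    ((hC1.contDiffAt (h.isOpen.mem_nhds (hSV hx))).differentiableAt one_ne_zero).hasFDerivAt
  have hUd : HasFDerivAt U (fderiv ℝ U (φ x)) (φ x) :=
    ((hU.contDiffAt (Metric.isOpen_ball.mem_nhds hxM.1)).differentiableAt (by simp)).hasFDerivAt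
  -- `U` is constant along the parametrization, so its gradient is normal to the tangent space.
  have hconst : HasFDerivAt (U ∘ φ) (0 : ParamSpace n →L[ℝ] ℝ) x :=
    (hasFDerivAt_const c x).congr_of_eventuallyEq (by
      filter_upwards [h.isOpen.mem_nhds (hSV hx)] with y hy
      exact (h.mapsTo hy).2)
  have hzero := (hUd.comp x hφd).unique hconst
  have ht : ∀ v, inner ℝ (fderiv ℝ φ x v) (gradient U (φ x)) = 0 := fun v => by
    rw [real_inner_comm, gradient, InnerProductSpace.toDual_symm_apply]
    exact congrArg (fun A : ParamSpace n →L[ℝ] ℝ => A v) hzero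
  rw [areaDensity_eq hn hxM.1 (hregular _ hxM.1 hxM.2) ht,
    ENNReal.ofReal_mul (LinearMap.normDet_nonneg _)]
  rfl

/-- A regular level set is a countable disjoint union of parametrized pieces. -/
theorem exists_pieces_iUnion_eq (hn : 1 ≤ n) {U : Cn n → ℝ} {c : ℝ}
    (hU : ContDiffOn ℝ ∞ U (unitBall n))
    (hregular : ∀ z ∈ unitBall n, U z = c → gradient U z ≠ 0)
    (hne : {z ∈ unitBall n | U z = c}.Nonempty) :
    ∃ P : Pieces {z ∈ unitBall n | U z = c},
      ⋃ k, P.φ k '' P.S k = {z ∈ unitBall n | U z = c} := by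
  set M := {z ∈ unitBall n | U z = c}
  obtain ⟨W, hW, hcov⟩ := exists_seq_isOpen_cover_of_local (V := M) (S := M)
    (P := fun _ W => ∃ V φ, IsLocalParam M V φ ∧ φ '' V = M ∩ W) subset_rfl (fun z hz => by
      obtain ⟨W, hWo, hzW, V, φ, hφ, himg, -⟩ :=
        exists_isLocalParam hn hU hz.1 hz.2 (hregular z hz.1 hz.2)
      exact ⟨W, hWo, hzW, V, φ, hφ, himg⟩) hne
  choose hWo x hx V φ hφ himg using hW
  have hWm : ∀ k, MeasurableSet (disjointed W k) := fun k =>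
    MeasurableSet.disjointed (fun k => (hWo k).measurableSet) k
  -- Disjointness is arranged in the ambient space and pulled back to the parameters.
  have himgS : ∀ k, φ k '' (V k ∩ φ k ⁻¹' disjointed W k) = M ∩ disjointed W k := fun k => by
    rw [image_inter_preimage, himg, inter_assoc, inter_eq_right.2 (disjointed_subset W k)]
  refine ⟨{ V, φ, S := fun k => V k ∩ φ k ⁻¹' disjointed W k, isLocalParam := hφ
            measurableSet := fun k => ?_, subset := fun k => inter_subset_left
            disjoint := fun k l hkl => ?_ }, ?_⟩
  · have := (hφ k).isOpen.measurableSet.subtype_image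
      ((hφ k).smooth.continuousOn.domRestrict.measurable (hWm k))
    rwa [domRestrict_eq, preimage_comp, Subtype.image_preimage_coe] at this
  · change Disjoint (φ k '' _) (φ l '' _)
    rw [himgS, himgS]
    exact (disjoint_disjointed W hkl).mono inter_subset_right inter_subset_right
  · simp only [himgS]
    rw [← inter_iUnion, iUnion_disjointed, inter_eq_left.2 hcov]

/-- Each family of pieces contributes the integral over its disjoint union, a subset of `M`; an
exhausting family attains the full integral. -/
theorem bergmanPerimeter_eq_lintegral (hn : 1 ≤ n) {U : Cn n → ℝ} {c : ℝ}
    (hU : ContDiffOn ℝ ∞ U (unitBall n))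
    (hregular : ∀ z ∈ unitBall n, U z = c → gradient U z ≠ 0) :
    bergmanPerimeter {z ∈ unitBall n | U z = c} =
      ∫⁻ z in {z ∈ unitBall n | U z = c},
        ENNReal.ofReal (perimeterIntegrand U z) ∂μHE[2 * n - 1] := by
  set M := {z ∈ unitBall n | U z = c} with hM
  have hsum : ∀ P : Pieces M, ∑' k, ∫⁻ x in P.S k, ENNReal.ofReal (areaDensity (P.φ k) x) =
      ∫⁻ z in ⋃ k, P.φ k '' P.S k,
        ENNReal.ofReal (perimeterIntegrand U z) ∂μHE[2 * n - 1] := fun P => by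
    rw [lintegral_iUnion (fun k => (P.measurableSet k).image_of_continuousOn_injOn
      ((P.isLocalParam k).smooth.continuousOn.mono (P.subset k))
      ((P.isLocalParam k).injOn.mono (P.subset k))) P.disjoint]
    exact tsum_congr fun k => (P.isLocalParam k).lintegral_areaDensity hn hU hregular
      (P.measurableSet k) (P.subset k)
  refine le_antisymm (iSup_le fun P => ?_) ?_
  · rw [hsum]
    exact lintegral_mono_set (iUnion_subset fun k =>
      ((P.isLocalParam k).mapsTo.mono_left (P.subset k)).image_subset)
  · rcases M.eq_empty_or_nonempty with he | hne
    · simp [he]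
    · obtain ⟨P, hP⟩ := exists_pieces_iUnion_eq hn hU hregular hne
      refine le_trans (le_of_eq ?_) (le_iSup _ P)
      rw [hsum, hP]

/-- Each point of `M` has a relative neighbourhood of finite area, and finitely many of these cover
`M`. -/
theorem euclideanHausdorffMeasure_levelSet_lt_top (hn : 1 ≤ n) {U : Cn n → ℝ} {c : ℝ}
    (hU : ContDiffOn ℝ ∞ U (unitBall n)) (hcompact : IsCompact {z ∈ unitBall n | U z = c})
    (hregular : ∀ z ∈ unitBall n, U z = c → gradient U z ≠ 0) :
    μHE[2 * n - 1] {z ∈ unitBall n | U z = c} < ⊤ := by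
  refine hcompact.measure_lt_top_of_nhdsWithin fun z hz => ?_
  obtain ⟨W, hWo, hzW, -, -, -, -, hfin⟩ :=
    exists_isLocalParam hn hU hz.1 hz.2 (hregular z hz.1 hz.2)
  exact ⟨_, inter_mem_nhdsWithin _ (hWo.mem_nhds hzW), hfin⟩

end BergmanBall

theorem mainTheorem3 (n : ℕ) (hn : 1 ≤ n) (U : BergmanBall.Cn n → ℝ) (c : ℝ)
    (hU : ContDiffOn ℝ ∞ U (BergmanBall.unitBall n))
    (hcompact : IsCompact {z ∈ BergmanBall.unitBall n | U z = c})
    (hregular : ∀ z ∈ BergmanBall.unitBall n, U z = c → gradient U z ≠ 0) :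
    IntegrableOn (BergmanBall.perimeterIntegrand U) {z ∈ BergmanBall.unitBall n | U z = c}
        (Measure.euclideanHausdorffMeasure (2 * n - 1)) ∧
      BergmanBall.bergmanPerimeter {z ∈ BergmanBall.unitBall n | U z = c} =
        ENNReal.ofReal (∫ z in {z ∈ BergmanBall.unitBall n | U z = c},
          BergmanBall.perimeterIntegrand U z
            ∂(Measure.euclideanHausdorffMeasure (2 * n - 1))) := by
  have hcont := BergmanBall.continuousOn_perimeterIntegrand hU hregular
  have hmeas := hcompact.isClosed.measurableSet
  have hfin := BergmanBall.euclideanHausdorffMeasure_levelSet_lt_top hn hU hcompact hregular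
  obtain ⟨C, hC⟩ := hcompact.exists_bound_of_continuousOn hcont
  have hint : IntegrableOn (BergmanBall.perimeterIntegrand U)
      {z ∈ BergmanBall.unitBall n | U z = c} (Measure.euclideanHausdorffMeasure (2 * n - 1)) :=
    IntegrableOn.of_bound hfin (hcont.aestronglyMeasurable hmeas) C
      (ae_restrict_of_forall_mem hmeas hC)
  refine ⟨hint, ?_⟩
  rw [BergmanBall.bergmanPerimeter_eq_lintegral hn hU hregular,
    ofReal_integral_eq_lintegral_ofReal hint (ae_restrict_of_forall_mem hmeas fun z hz =>
      BergmanBall.perimeterIntegrand_nonneg hz.1)]
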